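/- Let $f:\mathbb R^n\to\mathbb R$, $c:\mathbb R^n\to\mathbb R^p$, $A\in\mathbb R^{q\times n}$, $B\in\mathbb R^{q\times m}$, $b\in\mathbb R^q$, and consider the problem $$\min_{x,y}\ f(x)\quad\text{s.t.}\quad c(x)=0,\quad Ax+By=b. \tag{P}$$ Write $\nabla c(x)$ for the transposed Jacobian of $c$ and $\|\cdot\|$ for the Euclidean norm. Assume that $f$ and $c$ are continuously differentiable, and that $(x^*,y^*,\mu^*,\lambda^*)$ is a KKT point of (P), i.e. $\nabla f(x^*)+\nabla c(x^*)\mu^*+A^{T}\lambda^*=0$, $B^{T}\lambda^*=0$, $c(x^*)=0$, $Ax^*+By^*=b$. Assume that $f$ and $c$ are twice continuously differentiable on a neighborhood of $x^*$; that the rows of $$C=\begin{bmatrix}\nabla c(x^*)^{T}&0\\ A&B\end{bmatrix}$$ are linearly independent (LICQ); and that, with $H=\nabla^2 f(x^*)+\sum_j\mu_j^*\nabla^2c_j(x^*)$, $$z^{T}\begin{bmatrix}H&0\\0&0\end{bmatrix}z>0\quad\text{for all } z\ne0 \text{ with } Cz=0 .$$ For $\rho>0$, the ADMM (run without a stopping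 test) starts from $y^0\in\mathbb R^m$, $\lambda^0\in\mathbb R^q$ with $B^{T}\lambda^0=0$ and produces, for $k=0,1,2,\dots$: a local minimizer $x^{k+1}$ of the subproblem $$\min_x\ f(x)+(\lambda^k)^{T}(Ax+By^k-b)+\tfrac{\rho}{2}\|Ax+By^k-b\|^2\quad\text{s.t.}\quad c(x)=0, \tag{SP}$$ with a multiplier $\mu^{k+1}$ such that $(x^{k+1},\mu^{k+1})$ is a KKT point of (SP), i.e. $\nabla f(x^{k+1})+\nabla c(x^{k+1})\mu^{k+1}+A^{T}(\lambda^k+\rho(Ax^{k+1}+By^k-b))=0$ and $c(x^{k+1})=0$; then $$y^{k+1}\in\arg\min_y\big\{(\lambda^k)^{T}(Ax^{k+1}+By-b)+\tfrac{\rho}{2}\|Ax^{k+1}+By-b\|^2\big\},\qquad \lambda^{k+1}=\lambda^k+\rho(Ax^{k+1}+By^{k+1}-b).$$ Then there is $\rho^*>0$ such that for every $\rho>\rho^*$ there is $\varepsilon'>0$ with the following property. Let $\{(x^{k+1},y^k,\mu^{k+1},\lambda^k)\}_{k\ge 0}$ be any sequence produced by the ADMM with parameter $\rho$ such that, for every $k$,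 $(x^{k+1},\mu^{k+1})$ is closest to $(x^*,\mu^*)$ in Euclidean distance among all pairs $(x,\mu)$ for which $x$ is a local minimizer of (SP) and $(x,\mu)$ is a KKT point of (SP). If $\|(y^K,\lambda^K)-(y^*,\lambda^*)\|<\varepsilon'$ for some $K\ge 0$, then $(x^{k+1},y^{k+1},\mu^{k+1},\lambda^{k+1})\to(x^*,y^*,\mu^*,\lambda^*)$ as $k\to\infty$. -/

import Mathlib

open Topology Filter Matrix

noncomputable section

namespace ADMM

/-- The data of the problem `min f(x)` subject to `c(x) = 0`, `A x + B y = b`, with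
`x ∈ ℝⁿ`, `y ∈ ℝᵐ`, `c : ℝⁿ → ℝᵖ`, `A ∈ ℝ^{q × n}`, `B ∈ ℝ^{q × m}`, `b ∈ ℝ^q`. -/
structure Problem (n m p q : ℕ) where
  /-- the objective -/
  f : EuclideanSpace ℝ (Fin n) → ℝ
  /-- the nonlinear constraint function -/
  c : EuclideanSpace ℝ (Fin n) → EuclideanSpace ℝ (Fin p)
  /-- the matrix coupling `x` -/
  A : Matrix (Fin q) (Fin n) ℝ
  /-- the matrix coupling `y` -/
  B : Matrix (Fin q) (Fin m) ℝ
  /-- the right-hand side of the linear constraints -/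
  b : EuclideanSpace ℝ (Fin q)

/-- The Hessian matrix of `g` at `x`. -/
def hessian {n : ℕ} (g : EuclideanSpace ℝ (Fin n) → ℝ) (x : EuclideanSpace ℝ (Fin n)) :
    Matrix (Fin n) (Fin n) ℝ :=
  Matrix.of fun i j =>
    fderiv ℝ (fderiv ℝ g) x (EuclideanSpace.single i 1) (EuclideanSpace.single j 1)

/-- The Jacobian matrix of `c` at `x`: its `(j, i)` entry is `∂c_j/∂x_i (x)`. -/
def jacobian {n p : ℕ} (c : EuclideanSpace ℝ (Fin n) → EuclideanSpace ℝ (Fin p))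
    (x : EuclideanSpace ℝ (Fin n)) : Matrix (Fin p) (Fin n) ℝ :=
  Matrix.of fun j i => fderiv ℝ c x (EuclideanSpace.single i 1) j

/-- The Euclidean norm of a pair `(u, v)`, that is `(‖u‖² + ‖v‖²)^{1/2}`. -/
def pairNorm {k l : ℕ} (u : EuclideanSpace ℝ (Fin k)) (v : EuclideanSpace ℝ (Fin l)) : ℝ :=
  Real.sqrt (‖u‖ ^ 2 + ‖v‖ ^ 2)

namespace Problem

variable {n m p q : ℕ} (P : Problem n m p q)

/-- The residual `A x + B y - b` of the linear constraints. -/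
def linRes (x : EuclideanSpace ℝ (Fin n)) (y : EuclideanSpace ℝ (Fin m)) :
    EuclideanSpace ℝ (Fin q) :=
  P.A.toEuclideanLin x + P.B.toEuclideanLin y - P.b

/-- `∇f(x) + ∇c(x) μ + Aᵀ lam`, where the columns of `∇c(x)` are the gradients of the
components of `c`. -/
def gradLagrangian (x : EuclideanSpace ℝ (Fin n)) (mu : EuclideanSpace ℝ (Fin p))
    (lam : EuclideanSpace ℝ (Fin q)) : EuclideanSpace ℝ (Fin n) :=
  gradient P.f x + (jacobian P.c x)ᵀ.toEuclideanLin mu + P.Aᵀ.toEuclideanLin lam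

/-- `(x, y, μ, lam)` is a KKT point of the full problem. -/
structure IsKKT (x : EuclideanSpace ℝ (Fin n)) (y : EuclideanSpace ℝ (Fin m))
    (mu : EuclideanSpace ℝ (Fin p)) (lam : EuclideanSpace ℝ (Fin q)) : Prop where
  stationary_x : P.gradLagrangian x mu lam = 0
  stationary_y : P.Bᵀ.toEuclideanLin lam = 0
  feasible_c : P.c x = 0
  feasible_lin : P.linRes x y = 0

/-- `lamᵀ (A x + B y - b) + (ρ/2) ‖A x + B y - b‖²`. -/
def penalty (ρ : ℝ) (lam : EuclideanSpace ℝ (Fin q)) (x : EuclideanSpace ℝ (Fin n))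
    (y : EuclideanSpace ℝ (Fin m)) : ℝ :=
  inner ℝ lam (P.linRes x y) + ρ / 2 * ‖P.linRes x y‖ ^ 2

/-- `x` is a local minimizer of the subproblem
`min_x f(x) + lamᵀ (A x + B y - b) + (ρ/2) ‖A x + B y - b‖²` subject to `c(x) = 0`. -/
def IsSubLocalMin (ρ : ℝ) (y : EuclideanSpace ℝ (Fin m)) (lam : EuclideanSpace ℝ (Fin q))
    (x : EuclideanSpace ℝ (Fin n)) : Prop :=
  P.c x = 0 ∧ IsLocalMinOn (fun x' => P.f x' + P.penalty ρ lam x' y) {x' | P.c x' = 0} x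

/-- `(x, μ)` is a KKT point of the subproblem with parameters `ρ`, `y`, `lam`. -/
def IsSubKKT (ρ : ℝ) (y : EuclideanSpace ℝ (Fin m)) (lam : EuclideanSpace ℝ (Fin q))
    (x : EuclideanSpace ℝ (Fin n)) (mu : EuclideanSpace ℝ (Fin p)) : Prop :=
  P.gradLagrangian x mu (lam + ρ • P.linRes x y) = 0 ∧ P.c x = 0

/-- `(x, μ)` is a local minimizer/multiplier pair of the subproblem. -/
def IsSubPair (ρ : ℝ) (y : EuclideanSpace ℝ (Fin m)) (lam : EuclideanSpace ℝ (Fin q))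
    (x : EuclideanSpace ℝ (Fin n)) (mu : EuclideanSpace ℝ (Fin p)) : Prop :=
  P.IsSubLocalMin ρ y lam x ∧ P.IsSubKKT ρ y lam x mu

/-- The sequences `x`, `y`, `μ`, `lam` are generated by ADMM with penalty parameter `ρ`, run
without a stopping test, where the subproblem of every iteration returns a local minimizer
`x (k + 1)` together with a multiplier `mu (k + 1)` forming a KKT point.
The entries `x 0` and `mu 0` play no role. -/
structure IsIteration (ρ : ℝ) (x : ℕ → EuclideanSpace ℝ (Fin n))
    (y : ℕ → EuclideanSpace ℝ (Fin m)) (mu : ℕ → EuclideanSpace ℝ (Fin p))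
    (lam : ℕ → EuclideanSpace ℝ (Fin q)) : Prop where
  init : P.Bᵀ.toEuclideanLin (lam 0) = 0
  x_step : ∀ k, P.IsSubLocalMin ρ (y k) (lam k) (x (k + 1))
  mu_step : ∀ k, P.IsSubKKT ρ (y k) (lam k) (x (k + 1)) (mu (k + 1))
  y_step : ∀ k, IsMinOn (fun y' => P.penalty ρ (lam k) (x (k + 1)) y') Set.univ (y (k + 1))
  lam_step : ∀ k, lam (k + 1) = lam k + ρ • P.linRes (x (k + 1)) (y (k + 1))

/-- At every iteration `(x (k + 1), mu (k + 1))` is closest to `(xs, mus)` among all local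
minimizer/multiplier pairs of the subproblem. -/
def IsNearest (ρ : ℝ) (xs : EuclideanSpace ℝ (Fin n)) (mus : EuclideanSpace ℝ (Fin p))
    (x : ℕ → EuclideanSpace ℝ (Fin n)) (y : ℕ → EuclideanSpace ℝ (Fin m))
    (mu : ℕ → EuclideanSpace ℝ (Fin p)) (lam : ℕ → EuclideanSpace ℝ (Fin q)) : Prop :=
  ∀ k x' mu', P.IsSubPair ρ (y k) (lam k) x' mu' →
    pairNorm (x (k + 1) - xs) (mu (k + 1) - mus) ≤ pairNorm (x' - xs) (mu' - mus)

/-- The Jacobian `[[∇c(x)ᵀ, 0], [A, B]]` of all the constraints with respect to `(x, y)`. -/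
def constraintJacobian (x : EuclideanSpace ℝ (Fin n)) :
    Matrix (Fin p ⊕ Fin q) (Fin n ⊕ Fin m) ℝ :=
  Matrix.fromBlocks (jacobian P.c x) 0 P.A P.B

/-- `∇²f(x) + ∑ⱼ μⱼ ∇²cⱼ(x)`. -/
def hessianLagrangian (x : EuclideanSpace ℝ (Fin n)) (mu : EuclideanSpace ℝ (Fin p)) :
    Matrix (Fin n) (Fin n) ℝ :=
  hessian P.f x + ∑ j, mu j • hessian (fun z => P.c z j) x

/-- `f` and `c` are `C¹` everywhere and `C²` near `xs`, and `(xs, ys, mus, lams)` is a KKT point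
of the full problem at which the linear independence constraint qualification and the
second-order sufficient conditions hold. -/
structure IsRegularKKT (xs : EuclideanSpace ℝ (Fin n)) (ys : EuclideanSpace ℝ (Fin m))
    (mus : EuclideanSpace ℝ (Fin p)) (lams : EuclideanSpace ℝ (Fin q)) : Prop where
  f_contDiff : ContDiff ℝ 1 P.f
  c_contDiff : ContDiff ℝ 1 P.c
  kkt : P.IsKKT xs ys mus lams
  /-- For a finite order this says: `C²` on some neighborhood of `xs`. -/
  f_contDiffAt : ContDiffAt ℝ 2 P.f xs
  c_contDiffAt : ContDiffAt ℝ 2 P.c xs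
  licq : LinearIndependent ℝ (P.constraintJacobian xs).row
  sosc : ∀ z : Fin n ⊕ Fin m → ℝ, z ≠ 0 → P.constraintJacobian xs *ᵥ z = 0 →
    0 < z ⬝ᵥ (Matrix.fromBlocks (P.hessianLagrangian xs mus) 0 0 0 *ᵥ z)

end Problem

end ADMM

end

/-! Write d = x^{k+1} - x*, μ = μ^{k+1} - μ*, and e, e', l, l' for the errors of y^k, y^{k+1}, λ^k,
λ^{k+1}. The Lyapunov function is V = ‖l‖² + ρ²‖B e‖². All λ^k are orthogonal to the range of B, by
the initial condition and then by optimality in the y-step.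

Contraction. The multiplier estimate of the subproblem is λ^{k+1} + ρ B(e - e'). Subtracting the KKT
system at x* from the stationarity of x^{k+1} and testing with d leaves H d d, plus an inner product
that `energy_identity` rewrites as (V' - V)/(2ρ) plus squares, plus errors that are small relative
to (‖d‖ + ‖μ‖)². For large ρ the second-order condition makes the augmented Hessian coercive
(`exists_augmented_coercive`), so V drops by a multiple of ‖d‖² + ‖e'‖² + ‖B(e' - e)‖². LICQ
(`exists_multiplier_bound`) bounds μ and l' by the same quantities, so the drop dominates V' and V
contracts linearly (`exists_lyapunov_contraction`).

Localization. The contraction requires x^{k+1} near x*. For (y, λ) near (y*, λ*) the subproblem has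
a local minimizer with multiplier near (x*, μ*) (`eventually_exists_subproblem_pair`), because x* is
a strict local minimizer of the unperturbed subproblem. The nearest pair is at least as close.
Contraction keeps V below the threshold, so the argument iterates; `exists_penalty_tendsto`
assembles it. -/

namespace ADMM

/-! ### Coercivity from the second-order condition and multiplier bounds from LICQ. -/

section Abstract

variable {E F W Y : Type*}
  [NormedAddCommGroup E] [InnerProductSpace ℝ E]
  [NormedAddCommGroup F] [InnerProductSpace ℝ F]
  [NormedAddCommGroup W] [InnerProductSpace ℝ W]
  [NormedAddCommGroup Y] [InnerProductSpace ℝ Y]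

/-- Finsler's lemma for continuous functions that are homogeneous of degree two. -/
theorem exists_forall_le_add_mul {Z : Type*} [NormedAddCommGroup Z] [NormedSpace ℝ Z]
    [FiniteDimensional ℝ Z] {Q N : Z → ℝ} (hQ : Continuous Q) (hN : Continuous N)
    (hQ2 : ∀ (t : ℝ) z, Q (t • z) = t ^ 2 * Q z) (hN2 : ∀ (t : ℝ) z, N (t • z) = t ^ 2 * N z)
    (hN0 : ∀ z, 0 ≤ N z) (hpos : ∀ z, z ≠ 0 → N z = 0 → 0 < Q z) :
    ∃ ρ₀ : ℝ, 0 < ρ₀ ∧ ∃ κ : ℝ, 0 < κ ∧ ∀ ρ, ρ₀ ≤ ρ → ∀ z, κ * ‖z‖ ^ 2 ≤ Q z + ρ * N z := by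
  have : ProperSpace Z := FiniteDimensional.proper ℝ Z
  -- These open sets increase with k and cover the unit sphere, so one of them contains it; the
  -- margin 1/(k+1) then serves as κ, and homogeneity extends the bound to all z.
  let U : ℕ → Set Z := fun k => {z | 1 / ((k : ℝ) + 1) < Q z + k * N z}
  have hU : ∀ k z, z ∈ U k ↔ 1 / ((k : ℝ) + 1) < Q z + k * N z := fun _ _ => Iff.rfl
  have hmono : ∀ i j : ℕ, i ≤ j → U i ⊆ U j := by
    intro i j hij z hz
    rw [hU] at hz ⊢
    have h1 : (i : ℝ) ≤ j := by exact_mod_cast hij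
    have h2 : 1 / ((j : ℝ) + 1) ≤ 1 / ((i : ℝ) + 1) := by
      apply one_div_le_one_div_of_le <;> [positivity; linarith]
    have h3 := mul_le_mul_of_nonneg_right h1 (hN0 z)
    linarith
  obtain ⟨k, hk⟩ := (isCompact_sphere (0 : Z) 1).elim_directed_cover U
    (fun k => isOpen_lt continuous_const (by fun_prop)) (by
      intro z hz
      have hz0 : z ≠ 0 := by
        rintro rfl
        simp at hz
      rw [Set.mem_iUnion]
      rcases (hN0 z).eq_or_lt with h0 | h0
      · obtain ⟨k, hk⟩ := exists_nat_one_div_lt (hpos z hz0 h0.symm)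
        exact ⟨k, by rw [hU, ← h0]; simpa using hk⟩
      · obtain ⟨k, hk⟩ := exists_nat_gt ((1 - Q z) / N z)
        rw [div_lt_iff₀ h0] at hk
        refine ⟨k, ?_⟩
        have : 1 / ((k : ℝ) + 1) ≤ 1 := by
          rw [div_le_one (by positivity)]
          linarith [(Nat.cast_nonneg k : (0 : ℝ) ≤ k)]
        rw [hU]
        linarith)
    (directed_of_isDirected_le hmono)
  refine ⟨(k : ℝ) + 1, by positivity, 1 / ((k : ℝ) + 1), by positivity, fun ρ hρ z => ?_⟩
  rcases eq_or_ne z 0 with rfl | hz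
  · have h1 := hQ2 0 0
    have h2 := hN2 0 0
    simp only [zero_smul] at h1 h2
    norm_num at h1 h2
    simp [h1, h2]
  have hz' : 0 < ‖z‖ := norm_pos_iff.2 hz
  have h1 : ‖z‖⁻¹ • z ∈ U k := hk (by simp [norm_smul, hz'.ne'])
  rw [hU, hQ2, hN2] at h1
  have h2 : 1 / ((k : ℝ) + 1) * ‖z‖ ^ 2 ≤
      (‖z‖⁻¹ ^ 2 * Q z + k * (‖z‖⁻¹ ^ 2 * N z)) * ‖z‖ ^ 2 := by gcongr
  have h3 : (‖z‖⁻¹ ^ 2 * Q z + k * (‖z‖⁻¹ ^ 2 * N z)) * ‖z‖ ^ 2 = Q z + k * N z := by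
    field_simp
  have h4 : (k : ℝ) * N z ≤ ρ * N z := mul_le_mul_of_nonneg_right (by linarith) (hN0 z)
  linarith

/-- The second-order condition yields coercivity of the augmented Hessian. -/
theorem exists_augmented_coercive [FiniteDimensional ℝ E] [FiniteDimensional ℝ Y]
    (J : E →L[ℝ] F) (A : E →L[ℝ] W) (B : Y →L[ℝ] W) (H : E →L[ℝ] E →L[ℝ] ℝ)
    (hpos : ∀ d e, (d, e) ≠ 0 → J d = 0 → A d + B e = 0 → 0 < H d d) :
    ∃ ρ₀ : ℝ, 0 < ρ₀ ∧ ∃ κ : ℝ, 0 < κ ∧ ∀ ρ, ρ₀ ≤ ρ → ∀ d e,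
      κ * (‖d‖ ^ 2 + ‖e‖ ^ 2) ≤ H d d + ρ * (‖J d‖ ^ 2 + ‖A d + B e‖ ^ 2) := by
  obtain ⟨ρ₀, hρ₀, κ, hκ, h⟩ := exists_forall_le_add_mul (Z := E × Y)
    (Q := fun z => H z.1 z.1) (N := fun z => ‖J z.1‖ ^ 2 + ‖A z.1 + B z.2‖ ^ 2)
    (by fun_prop) (by fun_prop)
    (by intro t z; simp; ring)
    (by
      intro t z
      simp only [Prod.smul_fst, Prod.smul_snd, map_smul, ← smul_add, norm_smul, mul_pow,
        Real.norm_eq_abs, sq_abs]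
      ring)
    (fun z => by positivity)
    (by
      rintro ⟨d, e⟩ hz h0
      dsimp only at h0
      have h1 : ‖J d‖ ^ 2 = 0 := by nlinarith [sq_nonneg ‖J d‖, sq_nonneg ‖A d + B e‖]
      have h2 : ‖A d + B e‖ ^ 2 = 0 := by nlinarith [sq_nonneg ‖J d‖, sq_nonneg ‖A d + B e‖]
      exact hpos d e hz (by simpa using h1) (by simpa using h2))
  -- The product carries the sup norm, so ‖d‖² + ‖e‖² ≤ 2‖(d, e)‖²; hence the factor 1/2.
  refine ⟨ρ₀, hρ₀, κ / 2, by positivity, fun ρ hρ d e => ?_⟩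
  have h1 := h ρ hρ (d, e)
  dsimp only at h1
  have h2 : ‖d‖ ^ 2 ≤ ‖(d, e)‖ ^ 2 := by gcongr; exact norm_fst_le (d, e)
  have h3 : ‖e‖ ^ 2 ≤ ‖(d, e)‖ ^ 2 := by gcongr; exact norm_snd_le (d, e)
  nlinarith

/-- The linear independence constraint qualification bounds multipliers by residuals. -/
theorem exists_multiplier_bound [FiniteDimensional ℝ E] [FiniteDimensional ℝ F]
    [FiniteDimensional ℝ W] [FiniteDimensional ℝ Y]
    (J : E →L[ℝ] F) (A : E →L[ℝ] W) (B : Y →L[ℝ] W)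
    (hinj : ∀ μ l, (∀ d, inner ℝ μ (J d) + inner ℝ l (A d) = 0) → (∀ e, inner ℝ l (B e) = 0) →
      μ = 0 ∧ l = 0) :
    ∃ C : ℝ, 0 < C ∧ ∀ μ l, (∀ e, inner ℝ l (B e) = 0) → ∀ M : ℝ,
      (∀ d, |inner ℝ μ (J d) + inner ℝ l (A d)| ≤ M * ‖d‖) → 0 ≤ M → ‖μ‖ + ‖l‖ ≤ C * M := by
  have := FiniteDimensional.complete ℝ E
  have := FiniteDimensional.complete ℝ F
  have := FiniteDimensional.complete ℝ W
  have := FiniteDimensional.complete ℝ Y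
  -- The transpose of the constraint Jacobian. LICQ says that it is injective, hence bounded below
  -- in finite dimension.
  let S : F × W →L[ℝ] E × Y :=
    ((J.adjoint.comp (.fst ℝ F W)) + (A.adjoint.comp (.snd ℝ F W))).prod
      (B.adjoint.comp (.snd ℝ F W))
  have hB : ∀ l, (∀ e, inner ℝ l (B e) = 0) → B.adjoint l = 0 := by
    intro l hl
    rw [← inner_self_eq_zero (𝕜 := ℝ), ContinuousLinearMap.adjoint_inner_left]
    exact hl _
  have hker : LinearMap.ker S.toLinearMap = ⊥ := by
    rw [LinearMap.ker_eq_bot']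
    rintro ⟨μ, l⟩ h
    have h' : S (μ, l) = 0 := h
    simp only [S, ContinuousLinearMap.prod_apply, _root_.add_apply,
      ContinuousLinearMap.comp_apply, ContinuousLinearMap.coe_fst',
      ContinuousLinearMap.coe_snd', Prod.mk_eq_zero] at h'
    obtain ⟨h1, h2⟩ := h'
    obtain ⟨rfl, rfl⟩ := hinj μ l
      (fun d => by
        rw [← ContinuousLinearMap.adjoint_inner_left, ← ContinuousLinearMap.adjoint_inner_left,
          ← inner_add_left, h1, inner_zero_left])
      (fun e => by rw [← ContinuousLinearMap.adjoint_inner_left, h2, inner_zero_left])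
    rfl
  obtain ⟨K, hK, hS⟩ := S.toLinearMap.exists_antilipschitzWith hker
  refine ⟨2 * K, by positivity, fun μ l hl M hM hM0 => ?_⟩
  set v := J.adjoint μ + A.adjoint l with hv
  have h1 : ‖(μ, l)‖ ≤ K * ‖S (μ, l)‖ := by
    simpa using hS.le_mul_dist (μ, l) 0
  have h2 : S (μ, l) = (v, 0) := by
    simp [S, hv, hB l hl]
  have h3 : ‖v‖ ≤ M := by
    have h4 := hM v
    rw [← ContinuousLinearMap.adjoint_inner_left, ← ContinuousLinearMap.adjoint_inner_left,
      ← inner_add_left, ← hv, real_inner_self_eq_norm_sq, abs_of_nonneg (sq_nonneg _)] at h4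
    rcases (norm_nonneg v).eq_or_lt with h5 | h5
    · rw [← h5]; exact hM0
    · nlinarith
  have h6 : ‖(v, (0 : Y))‖ = ‖v‖ := by simp [Prod.norm_def]
  rw [h2, h6] at h1
  have h7 : ‖μ‖ ≤ ‖(μ, l)‖ := norm_fst_le (μ, l)
  have h8 : ‖l‖ ≤ ‖(μ, l)‖ := norm_snd_le (μ, l)
  have h9 : (K : ℝ) * ‖v‖ ≤ K * M := by gcongr
  linarith

end Abstract

end ADMM

/-! ### Lyapunov contraction of one ADMM step. -/

namespace ADMM

section Abstract

variable {E F W Y : Type*}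
  [NormedAddCommGroup E] [InnerProductSpace ℝ E]
  [NormedAddCommGroup F] [InnerProductSpace ℝ F]
  [NormedAddCommGroup W] [InnerProductSpace ℝ W]
  [NormedAddCommGroup Y] [InnerProductSpace ℝ Y]

/-- Since l' - l = ρ(a + b') is orthogonal to b and b', one has 2ρ⟨l', a⟩ = 2⟨l', l' - l⟩ and ⟨b -
b', a⟩ = ⟨b' - b, b'⟩; polarization of both yields the squares. It is used with a = A d, b = B e, b'
= B e'. -/
theorem energy_identity {ρ : ℝ} {a b b' l l' : W} (hl : l' = l + ρ • (a + b'))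
    (h1 : inner ℝ l b = 0) (h2 : inner ℝ l b' = 0) (h3 : inner ℝ l' b = 0)
    (h4 : inner ℝ l' b' = 0) :
    2 * ρ * inner ℝ (l' + ρ • (b - b')) a =
      (‖l'‖ ^ 2 + ρ ^ 2 * ‖b'‖ ^ 2) - (‖l‖ ^ 2 + ρ ^ 2 * ‖b‖ ^ 2) +
        ρ ^ 2 * ‖a + b'‖ ^ 2 + ρ ^ 2 * ‖b' - b‖ ^ 2 := by
  subst hl
  simp only [← real_inner_self_eq_norm_sq, inner_add_left, inner_add_right, inner_sub_left,
    inner_sub_right, real_inner_smul_left, real_inner_smul_right, real_inner_comm a b,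
    real_inner_comm a b', real_inner_comm b b', real_inner_comm a l, real_inner_comm b l,
    real_inner_comm b' l] at *
  linear_combination 2 * ρ * h3 - 2 * ρ * h1 - 4 * ρ * h4 + 2 * ρ * h2

/-- The scalar core of the contraction: a, m, j, p, s, t stand for ‖d‖, ‖μ‖, ‖J d‖, ‖e'‖, ‖B e' - B
e‖, ‖A d + B e'‖. After multiplication by 2ρ, the penalty ρ/4 in the coercivity costs only ρ²t²/2,
which the ρ²t² of the energy identity absorbs. -/
theorem lyapunov_descent {ρ κ η a m j p s t h ip g V V' : ℝ} (hρ : 0 < ρ) (hη : 0 < η)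
    (hη1 : η ≤ 1) (hm : 0 ≤ m) (hj : 0 ≤ j) (hJ : j ≤ η * a)
    (hstat : h + ip + g ≤ η * (a + m) * a) (hip : -(m * j) ≤ ip)
    (hg : 2 * ρ * g = V' - V + ρ ^ 2 * t ^ 2 + ρ ^ 2 * s ^ 2)
    (hco : κ * (a ^ 2 + p ^ 2) ≤ h + ρ / 4 * (j ^ 2 + t ^ 2)) :
    V' - V + ρ ^ 2 * s ^ 2 + 2 * ρ * κ * (a ^ 2 + p ^ 2) ≤
      (6 * ρ + ρ ^ 2) * η * (a ^ 2 + m ^ 2) := by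
  have hjm : m * j ≤ m * (η * a) := by gcongr
  have hj2 : j ^ 2 ≤ η * a ^ 2 := by
    have h1 : j ^ 2 ≤ (η * a) ^ 2 := pow_le_pow_left₀ hj hJ 2
    have h2 : η * (η * a ^ 2) ≤ 1 * (η * a ^ 2) := by gcongr
    linarith [mul_pow η a 2]
  have e1 := mul_le_mul_of_nonneg_left hstat (by positivity : 0 ≤ 2 * ρ)
  have e2 := mul_le_mul_of_nonneg_left hco (by positivity : 0 ≤ 2 * ρ)
  have e3 := mul_le_mul_of_nonneg_left hjm (by positivity : 0 ≤ 2 * ρ)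
  have e4 := mul_le_mul_of_nonneg_left hj2 (by positivity : 0 ≤ ρ ^ 2)
  have e5 := mul_le_mul_of_nonneg_left hip (by positivity : 0 ≤ 2 * ρ)
  have e6 : 0 ≤ ρ * η * (a - m) ^ 2 := by positivity
  have e7 : 0 ≤ ρ ^ 2 * t ^ 2 := by positivity
  have e8 : 0 ≤ ρ * η * m ^ 2 := by positivity
  have e9 : 0 ≤ ρ ^ 2 * η * m ^ 2 := by positivity
  have e10 : 0 ≤ ρ * η * a ^ 2 := by positivity
  have e11 : 0 ≤ ρ ^ 2 * η * a ^ 2 := by positivity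
  linarith

/-- One ADMM step contracts the Lyapunov function `‖l‖² + ρ² ‖B e‖²` when the linearized
stationarity and feasibility conditions hold up to a small relative error. -/
theorem exists_lyapunov_contraction (J : E →L[ℝ] F) (A : E →L[ℝ] W) (B : Y →L[ℝ] W)
    (H : E →L[ℝ] E →L[ℝ] ℝ) {ρ κ C : ℝ} (hρ : 0 < ρ) (hκ : 0 < κ) (hC : 0 < C)
    (hco : ∀ d e, κ * (‖d‖ ^ 2 + ‖e‖ ^ 2) ≤
      H d d + ρ / 4 * (‖J d‖ ^ 2 + ‖A d + B e‖ ^ 2))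
    (hmul : ∀ μ l, (∀ e, inner ℝ l (B e) = 0) → ∀ M : ℝ,
      (∀ d, |inner ℝ μ (J d) + inner ℝ l (A d)| ≤ M * ‖d‖) → 0 ≤ M → ‖μ‖ + ‖l‖ ≤ C * M) :
    ∃ η : ℝ, 0 < η ∧ ∃ θ : ℝ, 0 ≤ θ ∧ θ < 1 ∧ ∃ γ : ℝ, 0 < γ ∧
      ∀ (d : E) (μ : F) (e e' : Y) (l l' : W), (∀ v, inner ℝ l (B v) = 0) →
        (∀ v, inner ℝ l' (B v) = 0) → l' = l + ρ • (A d + B e') → ‖J d‖ ≤ η * ‖d‖ →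
        (∀ v, |H d v + inner ℝ μ (J v) + inner ℝ (l' + ρ • (B e - B e')) (A v)| ≤
          η * (‖d‖ + ‖μ‖) * ‖v‖) →
        ‖l'‖ ^ 2 + ρ ^ 2 * ‖B e'‖ ^ 2 ≤ θ * (‖l‖ ^ 2 + ρ ^ 2 * ‖B e‖ ^ 2) ∧
        γ * (‖d‖ ^ 2 + ‖μ‖ ^ 2) ≤ ‖l‖ ^ 2 + ρ ^ 2 * ‖B e‖ ^ 2 := by
  -- With D = ‖d‖² + ‖e'‖² + ‖B e' - B e‖²: C' bounds ‖μ‖ and ‖l'‖ by C'(‖d‖ + ‖B e' - B e‖), κ₀ D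
  -- is the raw decrease of V, and N D, R D bound V' and ‖d‖² + ‖μ‖².
  set C' : ℝ := 1 + 2 * C * ‖H‖ + 2 * C * ρ * ‖A‖ with hC'
  set κ₀ : ℝ := min (2 * ρ * κ) (ρ ^ 2) with hκ₀
  set N : ℝ := 2 * C' ^ 2 + ρ ^ 2 * ‖B‖ ^ 2 + 1 with hN
  set R : ℝ := 1 + 2 * C' ^ 2 with hR
  have hκ₀pos : 0 < κ₀ := lt_min (by positivity) (by positivity)
  have hNpos : 0 < N := by positivity
  have hRpos : 0 < R := by positivity
  -- The second entry absorbs ‖μ‖ in the multiplier bound; the third makes the error at most half of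
  -- κ₀ D.
  set η : ℝ := min 1 (min (1 / (2 * C)) (κ₀ / (2 * (6 * ρ + ρ ^ 2) * R))) with hη
  have hη0 : 0 < η := lt_min one_pos (lt_min (by positivity) (by positivity))
  have hη1 : η ≤ 1 := min_le_left _ _
  have hηC : C * η ≤ 1 / 2 := by
    have : η ≤ 1 / (2 * C) := (min_le_right _ _).trans (min_le_left _ _)
    rw [le_div_iff₀ (by positivity)] at this
    linarith
  have hηκ : (6 * ρ + ρ ^ 2) * η * R ≤ κ₀ / 2 := by
    have : η ≤ κ₀ / (2 * (6 * ρ + ρ ^ 2) * R) := (min_le_right _ _).trans (min_le_right _ _)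
    rw [le_div_iff₀ (by positivity)] at this
    linarith
  refine ⟨η, hη0, (1 + κ₀ / (2 * N))⁻¹, by positivity, inv_lt_one_of_one_lt₀ (by
    have : 0 < κ₀ / (2 * N) := by positivity
    linarith), κ₀ / (2 * R), by positivity, ?_⟩
  intro d μ e e' l l' hl hl' hup hJ hstat
  have hEn := energy_identity hup (hl e) (hl e') (hl' e) (hl' e')
  have hst := (abs_le.1 (hstat d)).2
  have hcs := (abs_le.1 (abs_real_inner_le_norm μ (J d))).1
  have hcod := hco d e'
  have hM := hmul μ l' hl' (η * (‖d‖ + ‖μ‖) + ‖H‖ * ‖d‖ + ρ * ‖A‖ * ‖B e' - B e‖) (by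
    intro v
    have h1 : inner ℝ μ (J v) + inner ℝ l' (A v) =
        (H d v + inner ℝ μ (J v) + inner ℝ (l' + ρ • (B e - B e')) (A v)) - H d v +
          ρ * inner ℝ (B e' - B e) (A v) := by
      rw [inner_add_left, real_inner_smul_left, inner_sub_left, inner_sub_left]
      ring
    have h2 : |H d v| ≤ ‖H‖ * ‖d‖ * ‖v‖ := H.le_opNorm₂ d v
    have h3 : |ρ * inner ℝ (B e' - B e) (A v)| ≤ ρ * (‖B e' - B e‖ * (‖A‖ * ‖v‖)) := by
      rw [abs_mul, abs_of_pos hρ]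
      gcongr
      exact (abs_real_inner_le_norm _ _).trans (by gcongr; exact A.le_opNorm v)
    rw [h1]
    refine (abs_add_le _ _).trans ((add_le_add (abs_sub _ _) le_rfl).trans ?_)
    linarith [hstat v]) (by positivity)
  have hBe : ‖B e'‖ ^ 2 ≤ ‖B‖ ^ 2 * ‖e'‖ ^ 2 := by
    rw [← mul_pow]
    gcongr
    exact B.le_opNorm e'
  set V := ‖l‖ ^ 2 + ρ ^ 2 * ‖B e‖ ^ 2 with hV
  set V' := ‖l'‖ ^ 2 + ρ ^ 2 * ‖B e'‖ ^ 2 with hV'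
  have ha := norm_nonneg d
  have hm := norm_nonneg μ
  have hs := norm_nonneg (B e' - B e)
  have hj := norm_nonneg (J d)
  have hL := norm_nonneg l'
  have hH := norm_nonneg H
  have hA := norm_nonneg A
  generalize hta : ‖A d + B e'‖ = t at *
  generalize ‖B e' - B e‖ = s at *
  generalize hdd : ‖d‖ = a at *
  generalize hmm : ‖μ‖ = m at *
  generalize ‖J d‖ = j at *
  have hmL : m / 2 + ‖l'‖ ≤ a / 2 + C * ‖H‖ * a + C * ρ * ‖A‖ * s := by
    linarith [mul_le_mul_of_nonneg_right hηC (add_nonneg ha hm)]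
  have hC'as : a + 2 * C * ‖H‖ * a + 2 * C * ρ * ‖A‖ * s ≤ C' * (a + s) := by
    have h1 : 0 ≤ 2 * C * ‖H‖ * s := by positivity
    have h2 : 0 ≤ 2 * C * ρ * ‖A‖ * a := by positivity
    rw [hC']
    linarith
  have hsq : (C' * (a + s)) ^ 2 ≤ 2 * C' ^ 2 * (a ^ 2 + s ^ 2) := by
    linarith [mul_nonneg (sq_nonneg C') (sq_nonneg (a - s))]
  have hm2 : m ^ 2 ≤ 2 * C' ^ 2 * (a ^ 2 + s ^ 2) :=
    (pow_le_pow_left₀ hm (by linarith) 2).trans hsq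
  have hL2 : ‖l'‖ ^ 2 ≤ 2 * C' ^ 2 * (a ^ 2 + s ^ 2) :=
    (pow_le_pow_left₀ hL (by linarith) 2).trans hsq
  set D := a ^ 2 + ‖e'‖ ^ 2 + s ^ 2 with hD
  have hD0 : 0 ≤ D := by positivity
  have hamD : a ^ 2 + m ^ 2 ≤ R * D := by
    rw [hR, hD]
    linarith [mul_nonneg (sq_nonneg C') (sq_nonneg ‖e'‖), sq_nonneg s, sq_nonneg ‖e'‖]
  have hVD : V' ≤ N * D := by
    rw [hV', hN, hD]
    have h1 : ρ ^ 2 * ‖B e'‖ ^ 2 ≤ ρ ^ 2 * (‖B‖ ^ 2 * ‖e'‖ ^ 2) := by gcongr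
    have h2 : 0 ≤ C' ^ 2 * ‖e'‖ ^ 2 := by positivity
    have h3 : 0 ≤ ρ ^ 2 * ‖B‖ ^ 2 * (a ^ 2 + s ^ 2) := by positivity
    linarith [sq_nonneg a, sq_nonneg s, sq_nonneg ‖e'‖]
  have hdesc := lyapunov_descent hρ hη0 hη1 hm hj hJ hst hcs hEn hcod
  -- Together with V' ≤ N D this gives (1 + κ₀/(2N)) V' ≤ V, which explains θ.
  have hmain : V' + κ₀ / 2 * D ≤ V := by
    have e1 : κ₀ * D ≤ ρ ^ 2 * s ^ 2 + 2 * ρ * κ * (a ^ 2 + ‖e'‖ ^ 2) := by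
      have h1 : κ₀ * s ^ 2 ≤ ρ ^ 2 * s ^ 2 := by gcongr; exact min_le_right _ _
      have h2 : κ₀ * (a ^ 2 + ‖e'‖ ^ 2) ≤ 2 * ρ * κ * (a ^ 2 + ‖e'‖ ^ 2) := by
        gcongr; exact min_le_left _ _
      rw [hD]
      linarith
    have e2 : (6 * ρ + ρ ^ 2) * η * (a ^ 2 + m ^ 2) ≤ (6 * ρ + ρ ^ 2) * η * (R * D) := by gcongr
    have e3 := mul_le_mul_of_nonneg_right hηκ hD0
    linarith
  constructor
  · rw [← div_eq_inv_mul, le_div_iff₀ (by positivity)]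
    have h1 : V' * (κ₀ / (2 * N)) ≤ N * D * (κ₀ / (2 * N)) := by gcongr
    have h2 : N * D * (κ₀ / (2 * N)) = κ₀ / 2 * D := by field_simp
    linarith
  · have h1 : κ₀ / (2 * R) * (a ^ 2 + m ^ 2) ≤ κ₀ / (2 * R) * (R * D) := by gcongr
    have h2 : κ₀ / (2 * R) * (R * D) = κ₀ / 2 * D := by field_simp
    have h3 : 0 ≤ V' := by positivity
    linarith

end Abstract

end ADMM

/-! ### Stability of strict local minimizers, Taylor expansion and Lagrange multipliers. -/

namespace ADMM

section Abstract

variable {E F W Y : Type*}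
  [NormedAddCommGroup E] [InnerProductSpace ℝ E]
  [NormedAddCommGroup F] [InnerProductSpace ℝ F]
  [NormedAddCommGroup W] [InnerProductSpace ℝ W]
  [NormedAddCommGroup Y] [InnerProductSpace ℝ Y]

/-- A strict local minimizer on a closed set persists under perturbation of the objective. -/
theorem eventually_exists_isLocalMinOn {X Θ : Type*} [MetricSpace X] [ProperSpace X]
    [TopologicalSpace Θ] {S : Set X} (hS : IsClosed S) {Φ : Θ → X → ℝ}
    (hΦ : Continuous fun z : Θ × X => Φ z.1 z.2) {θ₀ : Θ} {x₀ : X} (hx₀ : x₀ ∈ S)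
    (hmin : ∀ᶠ x in 𝓝 x₀, x ∈ S → x ≠ x₀ → Φ θ₀ x₀ < Φ θ₀ x) {r : ℝ} (hr : 0 < r) :
    ∀ᶠ θ in 𝓝 θ₀, ∃ x, dist x x₀ < r ∧ x ∈ S ∧ IsLocalMinOn (Φ θ) S x := by
  obtain ⟨r₁, hr₁, h₁⟩ := Metric.eventually_nhds_iff.1 hmin
  set r₂ := min (r₁ / 2) r with hr₂
  have hr₂0 : 0 < r₂ := lt_min (by positivity) hr
  have hr₂1 : r₂ < r₁ := (min_le_left _ _).trans_lt (by linarith)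
  have hcomp : IsCompact (Metric.sphere x₀ r₂ ∩ S) := (isCompact_sphere x₀ r₂).inter_right hS
  -- By compactness the strict inequality on the sphere survives perturbation, so a minimizer over
  -- the closed ball lies in its interior.
  have hev : ∀ᶠ θ in 𝓝 θ₀, ∀ x ∈ Metric.sphere x₀ r₂ ∩ S, Φ θ x₀ < Φ θ x := by
    refine hcomp.eventually_forall_of_forall_eventually (P := fun θ x => Φ θ x₀ < Φ θ x) ?_
    rintro x ⟨hx, hxS⟩
    have hx' : dist x x₀ = r₂ := hx
    have hne : x ≠ x₀ := by
      rintro rfl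
      rw [dist_self] at hx'
      exact hr₂0.ne hx'
    have hc : Continuous fun z : Θ × X => Φ z.1 x₀ :=
      hΦ.comp (continuous_fst.prodMk continuous_const)
    exact hc.continuousAt.eventually_lt hΦ.continuousAt (h₁ (by rw [hx']; exact hr₂1) hxS hne)
  filter_upwards [hev] with θ hθ
  have hcomp' : IsCompact (Metric.closedBall x₀ r₂ ∩ S) :=
    (isCompact_closedBall x₀ r₂).inter_right hS
  obtain ⟨x, ⟨hxb, hxS⟩, hxmin⟩ := hcomp'.exists_isMinOn
    ⟨x₀, Metric.mem_closedBall_self hr₂0.le, hx₀⟩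
    (hΦ.comp (continuous_const.prodMk continuous_id : Continuous fun x : X => (θ, x))).continuousOn
  have hlt : dist x x₀ < r₂ := by
    refine lt_of_le_of_ne hxb fun h => ?_
    have h2 := hxmin ⟨Metric.mem_closedBall_self hr₂0.le, hx₀⟩
    exact absurd (hθ x ⟨h, hxS⟩) (not_lt.2 h2)
  refine ⟨x, hlt.trans_le (min_le_right _ _), hxS, ?_⟩
  have hmem : Metric.ball x₀ r₂ ∈ 𝓝[S] x :=
    mem_nhdsWithin_of_mem_nhds (Metric.isOpen_ball.mem_nhds hlt)
  filter_upwards [hmem, self_mem_nhdsWithin] with z hz hzS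
  exact hxmin ⟨Metric.ball_subset_closedBall hz, hzS⟩

/-- Second-order Taylor expansion at a point where the function is `C²`. -/
theorem eventually_taylor_two {G : E → ℝ} {x₀ : E} (hG : ContDiffAt ℝ 2 G x₀) {η : ℝ}
    (hη : 0 < η) :
    ∀ᶠ x in 𝓝 x₀, |G x - G x₀ - fderiv ℝ G x₀ (x - x₀) -
      1 / 2 * fderiv ℝ (fderiv ℝ G) x₀ (x - x₀) (x - x₀)| ≤ η * ‖x - x₀‖ ^ 2 := by
  have h1 : ContDiffAt ℝ 1 (fderiv ℝ G) x₀ := hG.fderiv_right (by norm_num)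
  have h2 : HasFDerivAt (fderiv ℝ G) (fderiv ℝ (fderiv ℝ G) x₀) x₀ :=
    (h1.differentiableAt (by norm_num)).hasFDerivAt
  have h3 : ∀ᶠ x in 𝓝 x₀, DifferentiableAt ℝ G x :=
    (hG.eventually (by norm_num)).mono fun x hx => hx.differentiableAt (by norm_num)
  obtain ⟨r, hr, hball⟩ := Metric.eventually_nhds_iff.1 (h3.and (h2.isLittleO.def hη))
  refine Metric.eventually_nhds_iff.2 ⟨r, hr, fun x hx => ?_⟩
  set d := x - x₀ with hd
  have hx' : ‖d‖ < r := by rwa [hd, ← dist_eq_norm]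
  have hin : ∀ t ∈ Set.Icc (0 : ℝ) 1, dist (x₀ + t • d) x₀ < r := by
    intro t ht
    rw [dist_eq_norm, add_sub_cancel_left, norm_smul, Real.norm_eq_abs, abs_of_nonneg ht.1]
    nlinarith [norm_nonneg d, ht.2]
  -- Mean value inequality for the remainder along the segment; its derivative is controlled by
  -- differentiability of the gradient at x₀ alone.
  have key := norm_image_sub_le_of_norm_deriv_le_segment_01'
    (f := fun t : ℝ => G (x₀ + t • d) - t * fderiv ℝ G x₀ d -
      1 / 2 * t ^ 2 * fderiv ℝ (fderiv ℝ G) x₀ d d)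
    (f' := fun t => fderiv ℝ G (x₀ + t • d) d - fderiv ℝ G x₀ d -
      t * fderiv ℝ (fderiv ℝ G) x₀ d d) (C := η * ‖d‖ ^ 2)
    (by
      intro t ht
      have hline : HasDerivAt (fun t : ℝ => x₀ + t • d) d t := by
        simpa using ((hasDerivAt_id t).smul_const d).const_add x₀
      have e1 := (hball (hin t ht)).1.hasFDerivAt.comp_hasDerivAt t hline
      have e2 := (hasDerivAt_id t).mul_const (fderiv ℝ G x₀ d)
      have e3 := (((hasDerivAt_id t).pow 2).const_mul (1 / 2 : ℝ)).mul_const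
        (fderiv ℝ (fderiv ℝ G) x₀ d d)
      refine (((e1.sub e2).sub e3).congr_deriv ?_).hasDerivWithinAt
      simp)
    (by
      intro t ht
      have ht' : t ∈ Set.Icc (0 : ℝ) 1 := ⟨ht.1, ht.2.le⟩
      have e1 := (hball (hin t ht')).2
      rw [add_sub_cancel_left, map_smul] at e1
      have e2 : fderiv ℝ G (x₀ + t • d) d - fderiv ℝ G x₀ d -
          t * fderiv ℝ (fderiv ℝ G) x₀ d d =
          (fderiv ℝ G (x₀ + t • d) - fderiv ℝ G x₀ - t • fderiv ℝ (fderiv ℝ G) x₀ d) d := by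
        simp
      rw [e2]
      refine (ContinuousLinearMap.le_opNorm _ d).trans ?_
      have e3 : ‖t • d‖ ≤ ‖d‖ := by
        rw [norm_smul, Real.norm_eq_abs, abs_of_nonneg ht.1]
        nlinarith [norm_nonneg d, ht.2]
      calc _ ≤ η * ‖t • d‖ * ‖d‖ := by gcongr
        _ ≤ η * ‖d‖ * ‖d‖ := by gcongr
        _ = η * ‖d‖ ^ 2 := by ring)
  have hxd : x₀ + d = x := by rw [hd]; abel
  simp only [one_smul, zero_smul, add_zero, hxd, Real.norm_eq_abs] at key
  refine le_trans (le_of_eq ?_) key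
  congr 1
  ring

/-- The objective of the subproblem as a function of the parameters `(y, l)` and of `x`. -/
noncomputable def subObjective (f : E → ℝ) (A : E →L[ℝ] W) (B : Y →L[ℝ] W) (b : W) (ρ : ℝ)
    (θ : Y × W) (x : E) : ℝ :=
  f x + (inner ℝ θ.2 (A x + B θ.1 - b) + ρ / 2 * ‖A x + B θ.1 - b‖ ^ 2)

/-- On {c = 0} the function f agrees with f + ⟨μ*, c⟩, whose first-order term cancels that of λ*,
leaving half of H + ρ AᵀA. Feasible displacements are almost tangent, ‖J d‖ ≤ η‖d‖, so the term ρ‖J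
d‖² in the coercivity costs at most κ/4·‖d‖². -/
theorem subObjective_strict_local_min {f : E → ℝ} {c : E → F} {A : E →L[ℝ] W} {B : Y →L[ℝ] W}
    {b : W} {xs : E} {ys : Y} {mus : F} {lams : W} {H : E →L[ℝ] E →L[ℝ] ℝ} {ρ κ : ℝ}
    (hρ : 0 < ρ) (hκ : 0 < κ) (hc : DifferentiableAt ℝ c xs) (hcs : c xs = 0)
    (hlin : A xs + B ys - b = 0)
    (hG : ContDiffAt ℝ 2 (fun x => f x + inner ℝ mus (c x)) xs)
    (hH : H = fderiv ℝ (fderiv ℝ fun x => f x + inner ℝ mus (c x)) xs)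
    (hstat : ∀ v, fderiv ℝ (fun x => f x + inner ℝ mus (c x)) xs v + inner ℝ lams (A v) = 0)
    (hco : ∀ d, κ * ‖d‖ ^ 2 ≤ H d d + ρ * (‖fderiv ℝ c xs d‖ ^ 2 + ‖A d‖ ^ 2)) :
    ∀ᶠ x in 𝓝 xs, x ∈ {x | c x = 0} → x ≠ xs →
      subObjective f A B b ρ (ys, lams) xs < subObjective f A B b ρ (ys, lams) x := by
  set η := min 1 (κ / (4 * ρ)) with hη
  have hη0 : 0 < η := lt_min one_pos (by positivity)
  have hηρ : ρ * η ^ 2 ≤ κ / 4 := by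
    have h1 : η ≤ κ / (4 * ρ) := min_le_right _ _
    have h2 : η ≤ 1 := min_le_left _ _
    rw [le_div_iff₀ (by positivity)] at h1
    nlinarith [mul_le_mul_of_nonneg_left h2 (by positivity : 0 ≤ ρ * η)]
  filter_upwards [eventually_taylor_two hG (by positivity : 0 < κ / 8),
    hc.hasFDerivAt.isLittleO.def hη0] with x hT hJ hx hne
  have hx0 : c x = 0 := hx
  rw [hx0, hcs, sub_zero, zero_sub, norm_neg] at hJ
  simp only [← hH, hx0, hcs, inner_zero_right, add_zero] at hT
  have h1 := hstat (x - xs)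
  have h2 := hco (x - xs)
  have h3 : A x + B ys - b = A (x - xs) := by
    rw [map_sub, eq_sub_iff_add_eq, ← sub_eq_zero, ← hlin]
    abel
  have h4 : 0 < ‖x - xs‖ ^ 2 := by
    have := norm_pos_iff.2 (sub_ne_zero.2 hne)
    positivity
  have h5 : ‖fderiv ℝ c xs (x - xs)‖ ^ 2 ≤ η ^ 2 * ‖x - xs‖ ^ 2 := by
    rw [← mul_pow]
    gcongr
  have h6 := mul_le_mul_of_nonneg_left h5 hρ.le
  have h7 := mul_le_mul_of_nonneg_right hηρ h4.le
  have h8 := (abs_le.1 hT).1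
  simp only [subObjective, hlin, h3, inner_zero_right, norm_zero]
  nlinarith

/-- Near a point where the derivative of `c` is onto, local minimizers on `{c = 0}` have
Lagrange multipliers. -/
theorem exists_multiplier {Φ : E → ℝ} {c : E → F} [FiniteDimensional ℝ E]
    [FiniteDimensional ℝ F] {x : E} {Φ' : E →L[ℝ] ℝ} {c' : E →L[ℝ] F}
    (hΦ : HasStrictFDerivAt Φ Φ' x) (hc : HasStrictFDerivAt c c' x) (hx : c x = 0)
    (hmin : IsLocalMinOn Φ {x | c x = 0} x)
    (hinj : ∀ μ : F, (∀ v, inner ℝ μ (c' v) = 0) → μ = 0) :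
    ∃ μ : F, ∀ v, Φ' v + inner ℝ μ (c' v) = 0 := by
  have := FiniteDimensional.complete ℝ E
  have := FiniteDimensional.complete ℝ F
  have hext : IsLocalExtrOn Φ {z | c z = c x} x := by
    rw [hx]
    exact Or.inl hmin
  obtain ⟨Λ, Λ₀, hne, h⟩ := hext.exists_linear_map_of_hasStrictFDerivAt hc hΦ
  set ν : F := (InnerProductSpace.toDual ℝ F).symm (LinearMap.toContinuousLinearMap Λ) with hν
  have hΛ : ∀ z, Λ z = inner ℝ ν z := by
    intro z
    rw [hν, InnerProductSpace.toDual_symm_apply]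
    rfl
  -- Otherwise ν would annihilate the range of c', contradicting `hinj`.
  have hΛ₀ : Λ₀ ≠ 0 := by
    rintro rfl
    have h0 : ν = 0 := hinj ν fun v => by
      rw [← hΛ]
      simpa using h v
    apply hne
    refine Prod.ext (LinearMap.ext fun z => ?_) rfl
    simp [hΛ, h0]
  refine ⟨Λ₀⁻¹ • ν, fun v => ?_⟩
  have h1 := h v
  rw [hΛ, smul_eq_mul] at h1
  rw [real_inner_smul_left]
  field_simp
  linarith

end Abstract

end ADMM

/-! ### Solvability of nearby subproblems and local convergence. -/

namespace ADMM

section Abstract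

variable {E F W Y : Type*}
  [NormedAddCommGroup E] [InnerProductSpace ℝ E]
  [NormedAddCommGroup F] [InnerProductSpace ℝ F]
  [NormedAddCommGroup W] [InnerProductSpace ℝ W]
  [NormedAddCommGroup Y] [InnerProductSpace ℝ Y]

theorem hasStrictFDerivAt_subObjective {f : E → ℝ} {A : E →L[ℝ] W} {B : Y →L[ℝ] W} {b : W}
    {ρ : ℝ} {θ : Y × W} {x : E} {f' : E →L[ℝ] ℝ} (hf : HasStrictFDerivAt f f' x) :
    HasStrictFDerivAt (subObjective f A B b ρ θ)
      (f' + (innerSL ℝ (θ.2 + ρ • (A x + B θ.1 - b))).comp A) x := by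
  have h1 : HasStrictFDerivAt (fun x => A x + B θ.1 - b) A x :=
    (A.hasStrictFDerivAt.add_const _).sub_const _
  have h2 := (innerSL ℝ θ.2).hasStrictFDerivAt.comp x h1
  have h3 := ((hasStrictFDerivAt_norm_sq (A x + B θ.1 - b)).comp x h1).const_mul (ρ / 2)
  refine (hf.add (h2.add h3)).congr_fderiv ?_
  ext v
  simp only [_root_.add_apply, ContinuousLinearMap.comp_apply, innerSL_apply_apply,
    _root_.smul_apply, inner_add_left, real_inner_smul_left, smul_eq_mul]
  ring

theorem tendsto_of_sq_norm_sub_le {Z : Type*} [NormedAddCommGroup Z] {z : ℕ → Z} {zs : Z}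
    {v : ℕ → ℝ} (hv : Tendsto v atTop (𝓝 0)) (C : ℝ)
    (h : ∀ᶠ k in atTop, ‖z k - zs‖ ^ 2 ≤ C * v k) : Tendsto z atTop (𝓝 zs) := by
  rw [tendsto_iff_norm_sub_tendsto_zero]
  have h1 : Tendsto (fun k => ‖z k - zs‖ ^ 2) atTop (𝓝 0) :=
    squeeze_zero' (Eventually.of_forall fun _ => sq_nonneg _) h
      (by simpa using hv.const_mul C)
  simpa [Real.sqrt_sq] using h1.sqrt

/-- Near a regular KKT point the subproblems have local minimizer/multiplier pairs. -/
theorem eventually_exists_subproblem_pair [FiniteDimensional ℝ E] [FiniteDimensional ℝ F]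
    {f : E → ℝ} {c : E → F} {A : E →L[ℝ] W} {B : Y →L[ℝ] W}
    {b : W} {xs : E} {ys : Y} {mus : F} {lams : W} {ρ C : ℝ}
    (hf : ContDiff ℝ 1 f) (hc : ContDiff ℝ 1 c) (hcs : c xs = 0)
    (hlin : A xs + B ys - b = 0)
    (hstat : ∀ v, fderiv ℝ f xs v + inner ℝ mus (fderiv ℝ c xs v) + inner ℝ lams (A v) = 0)
    (hC : 0 < C)
    (hmul : ∀ μ : F, ∀ M : ℝ, (∀ d, |inner ℝ μ (fderiv ℝ c xs d)| ≤ M * ‖d‖) → 0 ≤ M →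
      ‖μ‖ ≤ C * M)
    (hmin : ∀ᶠ x in 𝓝 xs, x ∈ {x | c x = 0} → x ≠ xs →
      subObjective f A B b ρ (ys, lams) xs < subObjective f A B b ρ (ys, lams) x)
    {r : ℝ} (hr : 0 < r) :
    ∀ᶠ θ in 𝓝 (ys, lams), ∃ x μ, ‖x - xs‖ < r ∧ ‖μ - mus‖ < r ∧ c x = 0 ∧
      IsLocalMinOn (subObjective f A B b ρ θ) {x | c x = 0} x ∧
      ∀ v, fderiv ℝ f x v + inner ℝ μ (fderiv ℝ c x v) +
        inner ℝ (θ.2 + ρ • (A x + B θ.1 - b)) (A v) = 0 := by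
  have := FiniteDimensional.proper ℝ E
  have hfc : Continuous f := hf.continuous
  have hf'c : Continuous (fderiv ℝ f) := hf.continuous_fderiv (by norm_num)
  have hc'c : Continuous (fderiv ℝ c) := hc.continuous_fderiv (by norm_num)
  -- Stationarity residual with the multiplier frozen at μ*. At a KKT pair it equals -⟨μ - μ*, c'(x)
  -- ·⟩, so its smallness forces μ close to μ*.
  let g : (Y × W) × E → (E →L[ℝ] ℝ) := fun z =>
    fderiv ℝ f z.2 + (innerSL ℝ mus).comp (fderiv ℝ c z.2) +
      (innerSL ℝ (z.1.2 + ρ • (A z.2 + B z.1.1 - b))).comp A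
  have hgc : Continuous g := by
    refine ((hf'c.comp continuous_snd).add
      (continuous_const.clm_comp (hc'c.comp continuous_snd))).add
      (Continuous.clm_comp ((innerSL ℝ).continuous.comp ?_) continuous_const)
    fun_prop
  have hg0 : g ((ys, lams), xs) = 0 := by
    ext v
    simpa only [g, _root_.add_apply, ContinuousLinearMap.comp_apply, hlin, smul_zero, add_zero,
      innerSL_apply_apply, _root_.zero_apply] using hstat v
  have hgs : ∀ᶠ z in 𝓝 ((ys, lams), xs), ‖g z‖ < r / (4 * C) := by
    have : Tendsto (fun z => ‖g z‖) (𝓝 ((ys, lams), xs)) (𝓝 0) := by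
      have h := hgc.norm.tendsto ((ys, lams), xs)
      rwa [hg0, norm_zero] at h
    exact this.eventually_lt_const (by positivity)
  have hc's : ∀ᶠ x in 𝓝 xs, ‖fderiv ℝ c x - fderiv ℝ c xs‖ < 1 / (2 * C) := by
    have : Tendsto (fun x => ‖fderiv ℝ c x - fderiv ℝ c xs‖) (𝓝 xs) (𝓝 0) := by
      have h := (hc'c.sub continuous_const : Continuous fun x => fderiv ℝ c x - fderiv ℝ c xs)
      simpa using h.norm.tendsto xs
    exact this.eventually_lt_const (by positivity)
  rw [nhds_prod_eq, Filter.eventually_prod_iff] at hgs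
  obtain ⟨pθ, hpθ, px, hpx, hpg⟩ := hgs
  obtain ⟨r₁, hr₁, hball⟩ := Metric.eventually_nhds_iff.1 (hpx.and hc's)
  have hex := eventually_exists_isLocalMinOn (S := {x | c x = 0})
    (isClosed_eq hc.continuous continuous_const)
    (Φ := subObjective f A B b ρ) (by unfold subObjective; fun_prop) hcs hmin
    (lt_min hr hr₁)
  filter_upwards [hex, hpθ] with θ ⟨x, hxd, hxc, hxm⟩ hθ
  obtain ⟨hx1, hx2⟩ := hball (hxd.trans_le (min_le_right _ _))
  -- Perturbing the Jacobian by less than 1/(2C) at most doubles the multiplier constant.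
  have hbound : ∀ μ : F, ∀ M : ℝ, (∀ d, |inner ℝ μ (fderiv ℝ c x d)| ≤ M * ‖d‖) → 0 ≤ M →
      ‖μ‖ ≤ 2 * C * M := by
    intro μ M hM hM0
    have h1 := hmul μ (M + ‖μ‖ * (1 / (2 * C))) (by
      intro d
      have e1 : inner ℝ μ (fderiv ℝ c xs d) =
          inner ℝ μ (fderiv ℝ c x d) - inner ℝ μ ((fderiv ℝ c x - fderiv ℝ c xs) d) := by
        rw [← inner_sub_right]
        simp
      have e2 : |inner ℝ μ ((fderiv ℝ c x - fderiv ℝ c xs) d)| ≤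
          ‖μ‖ * (1 / (2 * C) * ‖d‖) := by
        refine (abs_real_inner_le_norm _ _).trans ?_
        gcongr
        exact (ContinuousLinearMap.le_opNorm _ d).trans (by gcongr)
      rw [e1]
      refine (abs_sub _ _).trans ?_
      linarith [hM d]) (by positivity)
    have h2 : C * (M + ‖μ‖ * (1 / (2 * C))) = C * M + ‖μ‖ / 2 := by field_simp
    linarith
  obtain ⟨μ, hμ⟩ := exists_multiplier
    (hasStrictFDerivAt_subObjective (hf.contDiffAt.hasStrictFDerivAt (by norm_num)))
    (hc.contDiffAt.hasStrictFDerivAt (by norm_num)) hxc hxm (fun μ h0 => by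
      have := hbound μ 0 (fun d => by simp [h0 d]) le_rfl
      simpa using this)
  have hst : ∀ v, fderiv ℝ f x v + inner ℝ μ (fderiv ℝ c x v) +
      inner ℝ (θ.2 + ρ • (A x + B θ.1 - b)) (A v) = 0 := by
    intro v
    have h1 := hμ v
    simp only [_root_.add_apply, ContinuousLinearMap.comp_apply, innerSL_apply_apply] at h1
    linarith
  refine ⟨x, μ, ?_, ?_, hxc, hxm, hst⟩
  · rw [← dist_eq_norm]
    exact hxd.trans_le (min_le_left _ _)
  · have hg := (hpg hθ hx1).le
    refine (hbound (μ - mus) (r / (4 * C)) (fun v => ?_) (by positivity)).trans_lt ?_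
    · have e1 : inner ℝ (μ - mus) (fderiv ℝ c x v) = -(g (θ, x) v) := by
        simp only [g, _root_.add_apply, ContinuousLinearMap.comp_apply, innerSL_apply_apply]
        rw [inner_sub_left]
        linarith [hst v]
      rw [e1, abs_neg]
      exact ((g (θ, x)).le_opNorm v).trans (by gcongr)
    · have e1 : 2 * C * (r / (4 * C)) = r / 2 := by field_simp; ring
      rw [e1]
      linarith

/-- Local convergence of ADMM for problems between inner product spaces. -/
theorem exists_penalty_tendsto [FiniteDimensional ℝ E] [FiniteDimensional ℝ F]
    [FiniteDimensional ℝ W] [FiniteDimensional ℝ Y]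
    {f : E → ℝ} {c : E → F} {A : E →L[ℝ] W} {B : Y →L[ℝ] W}
    {b : W} {xs : E} {ys : Y} {mus : F} {lams : W}
    (hf : ContDiff ℝ 1 f) (hc : ContDiff ℝ 1 c)
    (hf2 : ContDiffAt ℝ 2 f xs) (hc2 : ContDiffAt ℝ 2 c xs) (hcs : c xs = 0)
    (hlin : A xs + B ys - b = 0)
    (hstat : ∀ v, fderiv ℝ f xs v + inner ℝ mus (fderiv ℝ c xs v) + inner ℝ lams (A v) = 0)
    (hstaty : ∀ v, inner ℝ lams (B v) = 0)
    (hlicq : ∀ μ l, (∀ d, inner ℝ μ (fderiv ℝ c xs d) + inner ℝ l (A d) = 0) →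
      (∀ e, inner ℝ l (B e) = 0) → μ = 0 ∧ l = 0)
    (hpos : ∀ d e, (d, e) ≠ 0 → fderiv ℝ c xs d = 0 → A d + B e = 0 →
      0 < fderiv ℝ (fderiv ℝ fun x => f x + inner ℝ mus (c x)) xs d d) :
    ∃ ρs : ℝ, 0 < ρs ∧ ∀ ρ : ℝ, ρs < ρ → ∃ ε : ℝ, 0 < ε ∧
      ∀ (x : ℕ → E) (y : ℕ → Y) (mu : ℕ → F) (lam : ℕ → W),
        (∀ k v, inner ℝ (lam k) (B v) = 0) →
        (∀ k, lam (k + 1) = lam k + ρ • (A (x (k + 1)) + B (y (k + 1)) - b)) →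
        (∀ k, c (x (k + 1)) = 0) →
        (∀ k v, fderiv ℝ f (x (k + 1)) v + inner ℝ (mu (k + 1)) (fderiv ℝ c (x (k + 1)) v) +
          inner ℝ (lam k + ρ • (A (x (k + 1)) + B (y k) - b)) (A v) = 0) →
        (∀ k x' mu', c x' = 0 →
          IsLocalMinOn (subObjective f A B b ρ (y k, lam k)) {x | c x = 0} x' →
          (∀ v, fderiv ℝ f x' v + inner ℝ mu' (fderiv ℝ c x' v) +
            inner ℝ (lam k + ρ • (A x' + B (y k) - b)) (A v) = 0) →
          ‖x (k + 1) - xs‖ ^ 2 ≤ ‖x' - xs‖ ^ 2 + ‖mu' - mus‖ ^ 2) →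
        (∃ K, ‖y K - ys‖ < ε ∧ ‖lam K - lams‖ < ε) →
        Tendsto (fun k : ℕ => (x (k + 1), y (k + 1), mu (k + 1), lam (k + 1))) atTop
          (𝓝 (xs, ys, mus, lams)) := by
  set G : E → ℝ := fun x => f x + inner ℝ mus (c x) with hGdef
  set H := fderiv ℝ (fderiv ℝ G) xs with hH
  set J := fderiv ℝ c xs with hJdef
  have hG2 : ContDiffAt ℝ 2 G xs := hf2.add (contDiffAt_const.inner ℝ hc2)
  have hG' : ∀ x v, fderiv ℝ G x v = fderiv ℝ f x v + inner ℝ mus (fderiv ℝ c x v) := by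
    intro x v
    have h1 : HasFDerivAt G (fderiv ℝ f x + (innerSL ℝ mus).comp (fderiv ℝ c x)) x :=
      ((hf.differentiable (by norm_num)) x).hasFDerivAt.add
        ((innerSL ℝ mus).hasFDerivAt.comp x ((hc.differentiable (by norm_num)) x).hasFDerivAt)
    rw [h1.fderiv]
    simp
  obtain ⟨ρ₀, hρ₀, κ, hκ, hco⟩ := exists_augmented_coercive J A B H hpos
  obtain ⟨C, hC, hmul⟩ := exists_multiplier_bound J A B hlicq
  -- The second-order condition at (0, e) with B e = 0 would read 0 < 0; so B is injective and V
  -- controls y.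
  have hBker : LinearMap.ker B.toLinearMap = ⊥ := by
    rw [LinearMap.ker_eq_bot']
    intro e (he : B e = 0)
    by_contra hne
    have := hpos 0 e (by simp [hne]) (by simp) (by simp [he])
    simp at this
  obtain ⟨L, hL, hBL⟩ := B.toLinearMap.exists_antilipschitzWith hBker
  have hBlow : ∀ e, ‖e‖ ≤ L * ‖B e‖ := fun e => by simpa using hBL.le_mul_dist e 0
  -- The contraction uses coercivity with penalty ρ/4, hence the factor 4.
  refine ⟨4 * ρ₀, by positivity, fun ρ hρ => ?_⟩
  have hρ0 : 0 < ρ := by linarith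
  obtain ⟨η, hη, θ, hθ0, hθ1, γ, hγ, hstep⟩ := exists_lyapunov_contraction J A B H hρ0 hκ hC
    (fun d e => hco (ρ / 4) (by linarith) d e) hmul
  have hmin := subObjective_strict_local_min (f := f) (c := c) (A := A) (B := B) (b := b)
    (xs := xs) (ys := ys) (mus := mus) (lams := lams) hρ0 hκ
    (hc.differentiable (by norm_num) xs) hcs hlin hG2 hH
    (fun v => by rw [← hGdef, hG']; exact hstat v)
    (fun d => by simpa using hco ρ (by linarith) d 0)
  have hmulJ : ∀ μ : F, ∀ M : ℝ, (∀ d, |inner ℝ μ (J d)| ≤ M * ‖d‖) → 0 ≤ M → ‖μ‖ ≤ C * M := by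
    intro μ M hM hM0
    simpa using hmul μ 0 (by simp) M (by simpa using hM) hM0
  have hG2d : HasFDerivAt (fderiv ℝ G) H xs :=
    ((hG2.fderiv_right (m := 1) (by norm_num)).differentiableAt (by norm_num)).hasFDerivAt
  have hJd : HasFDerivAt c J xs := (hc.differentiable (by norm_num) xs).hasFDerivAt
  have hJc : ∀ᶠ x in 𝓝 xs, ‖fderiv ℝ c x - J‖ < η := by
    have h := ((hc.continuous_fderiv (by norm_num)).sub continuous_const :
      Continuous fun x => fderiv ℝ c x - J)
    have h' : Tendsto (fun x => ‖fderiv ℝ c x - J‖) (𝓝 xs) (𝓝 0) := by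
      simpa [hJdef] using h.norm.tendsto xs
    exact h'.eventually_lt_const hη
  obtain ⟨r, hr, hnear⟩ := Metric.eventually_nhds_iff.1
    (((hG2d.isLittleO.def hη).and (hJd.isLittleO.def hη)).and hJc)
  have hpair := eventually_exists_subproblem_pair hf hc hcs hlin hstat hC hmulJ hmin
    (by positivity : 0 < r / 2)
  obtain ⟨δ, hδ, hpairδ⟩ := Metric.eventually_nhds_iff.1 hpair
  set V : Y → W → ℝ := fun e l => ‖l‖ ^ 2 + ρ ^ 2 * ‖B e‖ ^ 2 with hV
  have hVc : Tendsto (fun t : ℝ => t ^ 2 + ρ ^ 2 * (‖B‖ * t) ^ 2) (𝓝 0) (𝓝 0) := by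
    have : Continuous fun t : ℝ => t ^ 2 + ρ ^ 2 * (‖B‖ * t) ^ 2 := by fun_prop
    simpa using this.tendsto 0
  have hVy : ∀ e l, ‖e‖ ^ 2 ≤ L ^ 2 / ρ ^ 2 * V e l := by
    intro e l
    have h1 : ‖e‖ ^ 2 ≤ (L * ‖B e‖) ^ 2 := by gcongr; exact hBlow e
    have h2 : L ^ 2 / ρ ^ 2 * V e l = L ^ 2 / ρ ^ 2 * ‖l‖ ^ 2 + (L * ‖B e‖) ^ 2 := by
      rw [hV]; field_simp
    have h3 : 0 ≤ (L : ℝ) ^ 2 / ρ ^ 2 * ‖l‖ ^ 2 := by positivity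
    linarith
  have hVl : ∀ e l, ‖l‖ ^ 2 ≤ V e l := by
    intro e l
    have h3 : 0 ≤ ρ ^ 2 * ‖B e‖ ^ 2 := by positivity
    rw [hV]
    linarith
  set v₀ : ℝ := δ ^ 2 / (L ^ 2 / ρ ^ 2 + 1) with hv₀
  have hv₀0 : 0 < v₀ := by positivity
  have hVδ : ∀ e l, V e l < v₀ → ‖e‖ < δ ∧ ‖l‖ < δ := by
    intro e l h
    rw [hv₀, lt_div_iff₀ (by positivity)] at h
    have h1 := hVy e l
    have h2 := hVl e l
    have h0 : 0 ≤ V e l := (sq_nonneg _).trans h2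
    have h3 : 0 ≤ (L : ℝ) ^ 2 / ρ ^ 2 * V e l := by positivity
    constructor <;> refine lt_of_pow_lt_pow_left₀ 2 hδ.le ?_ <;> linarith
  obtain ⟨ε, hε, hεV⟩ := Metric.eventually_nhds_iff.1 (hVc.eventually_lt_const hv₀0)
  refine ⟨ε / 2, by positivity, ?_⟩
  intro x y mu lam horth hupd hfeas hst hnst ⟨K, hKy, hKl⟩
  have hVK : V (y K - ys) (lam K - lams) < v₀ := by
    refine lt_of_le_of_lt ?_ (hεV (y := ε / 2) (by
      rw [Real.dist_eq, sub_zero, abs_of_pos (by positivity)]; linarith))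
    rw [hV]
    have h1 : ‖B (y K - ys)‖ ≤ ‖B‖ * (ε / 2) := (B.le_opNorm _).trans (by gcongr)
    dsimp only
    gcongr
  have hone : ∀ k, V (y k - ys) (lam k - lams) < v₀ →
      V (y (k + 1) - ys) (lam (k + 1) - lams) ≤ θ * V (y k - ys) (lam k - lams) ∧
      γ * (‖x (k + 1) - xs‖ ^ 2 + ‖mu (k + 1) - mus‖ ^ 2) ≤ V (y k - ys) (lam k - lams) := by
    intro k hk
    obtain ⟨hk1, hk2⟩ := hVδ _ _ hk
    obtain ⟨x', mu', hx', hmu', hcx', hmin', hst'⟩ := hpairδ (y := (y k, lam k)) (by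
      rw [Prod.dist_eq, dist_eq_norm, dist_eq_norm]
      exact max_lt hk1 hk2)
    -- Only x^{k+1} needs to be localized: the multiplier error enters linearly and is absorbed in
    -- the contraction.
    have hn := hnst k x' mu' hcx' hmin' hst'
    have hxr : dist (x (k + 1)) xs < r := by
      rw [dist_eq_norm]
      refine lt_of_pow_lt_pow_left₀ 2 hr.le (hn.trans_lt ?_)
      have h1 := pow_lt_pow_left₀ hx' (norm_nonneg _) two_ne_zero
      have h2 := pow_lt_pow_left₀ hmu' (norm_nonneg _) two_ne_zero
      nlinarith
    obtain ⟨⟨hx1, hx2⟩, hx3⟩ := hnear hxr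
    rw [hfeas k, hcs, sub_zero, zero_sub, norm_neg] at hx2
    have hAB : A (x (k + 1)) + B (y (k + 1)) - b =
        A (x (k + 1) - xs) + B (y (k + 1) - ys) := by
      rw [map_sub, map_sub, ← sub_eq_zero, ← hlin]
      abel
    refine hstep (x (k + 1) - xs) (mu (k + 1) - mus) (y k - ys) (y (k + 1) - ys)
      (lam k - lams) (lam (k + 1) - lams) (fun v => by rw [inner_sub_left, horth, hstaty, sub_zero])
      (fun v => by rw [inner_sub_left, horth, hstaty, sub_zero])
      (by rw [← hAB, hupd k]; abel) hx2 (fun v => ?_)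
    have h1 := hst k v
    have h2 := hstat v
    have h3 : lam k + ρ • (A (x (k + 1)) + B (y k) - b) =
        lams + (lam (k + 1) - lams + ρ • (B (y k - ys) - B (y (k + 1) - ys))) := by
      rw [hupd k, ← map_sub, sub_sub_sub_cancel_right, map_sub]
      simp only [smul_sub, smul_add]
      abel
    rw [h3, inner_add_left lams] at h1
    -- The linearization error splits into the Taylor remainder of the gradient of f + ⟨μ*, c⟩ and
    -- the variation of the Jacobian acting on μ^{k+1} - μ*.
    have h4 : H (x (k + 1) - xs) v + inner ℝ (mu (k + 1) - mus) (J v) +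
        inner ℝ (lam (k + 1) - lams + ρ • (B (y k - ys) - B (y (k + 1) - ys))) (A v) =
        -((fderiv ℝ G (x (k + 1)) - fderiv ℝ G xs - H (x (k + 1) - xs)) v) -
          inner ℝ (mu (k + 1) - mus) ((fderiv ℝ c (x (k + 1)) - J) v) := by
      simp only [_root_.sub_apply, hG', inner_sub_left, inner_sub_right]
      rw [← hJdef]
      linarith
    rw [h4]
    refine (abs_sub _ _).trans ?_
    rw [abs_neg]
    have h5 : |(fderiv ℝ G (x (k + 1)) - fderiv ℝ G xs - H (x (k + 1) - xs)) v| ≤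
        η * ‖x (k + 1) - xs‖ * ‖v‖ :=
      (ContinuousLinearMap.le_opNorm (fderiv ℝ G (x (k + 1)) - fderiv ℝ G xs -
        H (x (k + 1) - xs)) v).trans (mul_le_mul_of_nonneg_right hx1 (norm_nonneg v))
    have h6 : |inner ℝ (mu (k + 1) - mus) ((fderiv ℝ c (x (k + 1)) - J) v)| ≤
        ‖mu (k + 1) - mus‖ * (η * ‖v‖) := by
      refine (abs_real_inner_le_norm _ _).trans ?_
      gcongr
      exact (ContinuousLinearMap.le_opNorm _ v).trans (by gcongr)
    linarith
  have hdecay : ∀ j, V (y (K + j) - ys) (lam (K + j) - lams) ≤ θ ^ j * V (y K - ys) (lam K - lams) ∧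
      V (y (K + j) - ys) (lam (K + j) - lams) < v₀ := by
    intro j
    induction j with
    | zero => exact ⟨by simp, hVK⟩
    | succ j ih =>
      have h1 := (hone (K + j) ih.2).1
      have h0 : 0 ≤ V (y (K + j) - ys) (lam (K + j) - lams) := (sq_nonneg _).trans (hVl _ _)
      rw [← add_assoc]
      constructor
      · refine h1.trans ?_
        rw [pow_succ', mul_assoc]
        exact mul_le_mul_of_nonneg_left ih.1 hθ0
      · refine h1.trans_lt (lt_of_le_of_lt ?_ ih.2)
        exact mul_le_of_le_one_left h0 hθ1.le
  have hV0 : Tendsto (fun k => V (y k - ys) (lam k - lams)) atTop (𝓝 0) := by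
    rw [← tendsto_add_atTop_iff_nat K]
    refine squeeze_zero (g := fun j => θ ^ j * V (y K - ys) (lam K - lams)) (fun j => (sq_nonneg _).trans (hVl _ _)) (fun j => by
      rw [add_comm j K]; exact (hdecay j).1) ?_
    simpa using (tendsto_pow_atTop_nhds_zero_of_lt_one hθ0 hθ1).mul_const
      (V (y K - ys) (lam K - lams))
  have hVK' : ∀ᶠ k in atTop, V (y k - ys) (lam k - lams) < v₀ := hV0.eventually_lt_const hv₀0
  have hx : Tendsto (fun k => x (k + 1)) atTop (𝓝 xs) := by
    refine tendsto_of_sq_norm_sub_le hV0 γ⁻¹ (hVK'.mono fun k hk => ?_)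
    rw [← div_eq_inv_mul, le_div_iff₀ hγ]
    have := (hone k hk).2
    nlinarith [mul_nonneg hγ.le (sq_nonneg ‖mu (k + 1) - mus‖)]
  have hmu : Tendsto (fun k => mu (k + 1)) atTop (𝓝 mus) := by
    refine tendsto_of_sq_norm_sub_le hV0 γ⁻¹ (hVK'.mono fun k hk => ?_)
    rw [← div_eq_inv_mul, le_div_iff₀ hγ]
    have := (hone k hk).2
    nlinarith [mul_nonneg hγ.le (sq_nonneg ‖x (k + 1) - xs‖)]
  have hy : Tendsto y atTop (𝓝 ys) :=
    tendsto_of_sq_norm_sub_le hV0 (L ^ 2 / ρ ^ 2) (Eventually.of_forall fun k => hVy _ _)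
  have hl : Tendsto lam atTop (𝓝 lams) :=
    tendsto_of_sq_norm_sub_le hV0 1 (Eventually.of_forall fun k => by rw [one_mul]; exact hVl _ _)
  exact hx.prodMk_nhds (((tendsto_add_atTop_iff_nat 1).2 hy).prodMk_nhds
    (hmu.prodMk_nhds ((tendsto_add_atTop_iff_nat 1).2 hl)))

end Abstract

end ADMM

/-! ### Translation of the matrix formulation into operators and derivatives. -/

namespace ADMM

variable {n m p q : ℕ}

theorem inner_transpose_toEuclideanLin {k l : ℕ} (M : Matrix (Fin k) (Fin l) ℝ)
    (u : EuclideanSpace ℝ (Fin k)) (v : EuclideanSpace ℝ (Fin l)) :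
    inner ℝ (Mᵀ.toEuclideanLin u) v = inner ℝ u (M.toEuclideanLin v) := by
  rw [← Matrix.conjTranspose_eq_transpose_of_trivial, Matrix.toEuclideanLin_conjTranspose_eq_adjoint,
    LinearMap.adjoint_inner_left]

theorem sum_smul_single {k : ℕ} (v : EuclideanSpace ℝ (Fin k)) :
    ∑ i, v i • EuclideanSpace.single i (1 : ℝ) = v := by
  simpa using (EuclideanSpace.basisFun (Fin k) ℝ).sum_repr v

theorem jacobian_toEuclideanLin (c : EuclideanSpace ℝ (Fin n) → EuclideanSpace ℝ (Fin p))
    (x v : EuclideanSpace ℝ (Fin n)) : (jacobian c x).toEuclideanLin v = fderiv ℝ c x v := by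
  conv_rhs => rw [← sum_smul_single v]
  ext j
  simp [jacobian, Matrix.mulVec, dotProduct, mul_comm]

theorem hessian_dotProduct (g : EuclideanSpace ℝ (Fin n) → ℝ) (x d : EuclideanSpace ℝ (Fin n)) :
    d.ofLp ⬝ᵥ (hessian g x *ᵥ d.ofLp) = fderiv ℝ (fderiv ℝ g) x d d := by
  conv_rhs => rw [← sum_smul_single d]
  simp only [map_sum, map_smul, hessian, dotProduct, Matrix.mulVec, Matrix.of_apply,
    _root_.sum_apply, _root_.smul_apply, smul_eq_mul, Finset.mul_sum]
  rw [Finset.sum_comm]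
  refine Finset.sum_congr rfl fun i _ => Finset.sum_congr rfl fun j _ => ?_
  ring

namespace Problem

variable (P : Problem n m p q)

/-- The continuous linear map of the matrix `A`. -/
noncomputable def opA : EuclideanSpace ℝ (Fin n) →L[ℝ] EuclideanSpace ℝ (Fin q) :=
  LinearMap.toContinuousLinearMap P.A.toEuclideanLin

/-- The continuous linear map of the matrix `B`. -/
noncomputable def opB : EuclideanSpace ℝ (Fin m) →L[ℝ] EuclideanSpace ℝ (Fin q) :=
  LinearMap.toContinuousLinearMap P.B.toEuclideanLin

theorem linRes_eq (x : EuclideanSpace ℝ (Fin n)) (y : EuclideanSpace ℝ (Fin m)) :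
    P.linRes x y = P.opA x + P.opB y - P.b := rfl

theorem inner_gradLagrangian (x : EuclideanSpace ℝ (Fin n)) (mu : EuclideanSpace ℝ (Fin p))
    (lam : EuclideanSpace ℝ (Fin q)) (v : EuclideanSpace ℝ (Fin n)) :
    inner ℝ (P.gradLagrangian x mu lam) v =
      fderiv ℝ P.f x v + inner ℝ mu (fderiv ℝ P.c x v) + inner ℝ lam (P.opA v) := by
  rw [gradLagrangian, inner_add_left, inner_add_left, inner_transpose_toEuclideanLin,
    inner_transpose_toEuclideanLin, jacobian_toEuclideanLin, gradient,
    InnerProductSpace.toDual_symm_apply]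
  rfl

theorem gradLagrangian_eq_zero_iff {x : EuclideanSpace ℝ (Fin n)} {mu : EuclideanSpace ℝ (Fin p)}
    {lam : EuclideanSpace ℝ (Fin q)} : P.gradLagrangian x mu lam = 0 ↔ ∀ v,
      fderiv ℝ P.f x v + inner ℝ mu (fderiv ℝ P.c x v) + inner ℝ lam (P.opA v) = 0 := by
  refine ⟨fun h v => ?_, fun h => ?_⟩
  · rw [← inner_gradLagrangian, h, inner_zero_left]
  · rw [← inner_self_eq_zero (𝕜 := ℝ), inner_gradLagrangian]
    exact h _

theorem inner_opB_eq_zero {lam : EuclideanSpace ℝ (Fin q)} (h : P.Bᵀ.toEuclideanLin lam = 0)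
    (v : EuclideanSpace ℝ (Fin m)) : inner ℝ lam (P.opB v) = 0 := by
  change inner ℝ lam (P.B.toEuclideanLin v) = 0
  rw [← inner_transpose_toEuclideanLin, h, inner_zero_left]

/-- First-order optimality in the `y`-step. -/
theorem inner_opB_eq_zero_of_isMinOn {ρ : ℝ} {lam : EuclideanSpace ℝ (Fin q)}
    {x : EuclideanSpace ℝ (Fin n)} {y : EuclideanSpace ℝ (Fin m)}
    (h : IsMinOn (fun y' => P.penalty ρ lam x y') Set.univ y) (v : EuclideanSpace ℝ (Fin m)) :
    inner ℝ (lam + ρ • P.linRes x y) (P.opB v) = 0 := by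
  -- The y-step is a subproblem with zero objective and the roles of A and B exchanged.
  have hmin : IsLocalMin (subObjective (fun _ => (0 : ℝ)) P.opB P.opA P.b ρ (x, lam)) y := by
    refine Eventually.of_forall fun y' => ?_
    have h1 := h (Set.mem_univ y')
    simpa [subObjective, penalty, linRes_eq, add_comm] using h1
  have h2 := hmin.hasFDerivAt_eq_zero
    (hasStrictFDerivAt_subObjective (hasStrictFDerivAt_const (0 : ℝ) y)).hasFDerivAt
  have h3 := congrArg (fun T => T v) h2
  simp only [ContinuousLinearMap.comp_apply, innerSL_apply_apply, _root_.zero_apply,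
    zero_add] at h3
  rwa [linRes_eq, add_comm (P.opA x)]

theorem hessianLagrangian_dotProduct {x : EuclideanSpace ℝ (Fin n)}
    {mu : EuclideanSpace ℝ (Fin p)} (hf : ContDiffAt ℝ 2 P.f x) (hc : ContDiffAt ℝ 2 P.c x)
    (d : EuclideanSpace ℝ (Fin n)) :
    d.ofLp ⬝ᵥ (P.hessianLagrangian x mu *ᵥ d.ofLp) =
      fderiv ℝ (fderiv ℝ fun z => P.f z + inner ℝ mu (P.c z)) x d d := by
  have hcj : ∀ j, ContDiffAt ℝ 2 (fun z => P.c z j) x := fun j => contDiffAt_euclidean.1 hc j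
  have hG : (fun z => P.f z + inner ℝ mu (P.c z)) = fun z => P.f z + ∑ j, mu j * P.c z j := by
    ext z
    simp [PiLp.inner_apply, mul_comm]
  -- The first derivative is needed on a neighborhood so that it can be differentiated again at x.
  have h1 : fderiv ℝ (fun z => P.f z + ∑ j, mu j * P.c z j) =ᶠ[𝓝 x]
      fun z => fderiv ℝ P.f z + ∑ j, mu j • fderiv ℝ (fun z => P.c z j) z := by
    filter_upwards [hf.eventually (by norm_num),
      eventually_all.2 fun j => (hcj j).eventually (by norm_num)] with z hz1 hz2
    exact ((hz1.differentiableAt (by norm_num)).hasFDerivAt.add (HasFDerivAt.fun_sum fun j _ =>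
      ((hz2 j).differentiableAt (by norm_num)).hasFDerivAt.const_mul (mu j))).fderiv
  have h2 : HasFDerivAt (fun z => fderiv ℝ P.f z + ∑ j, mu j • fderiv ℝ (fun z => P.c z j) z)
      (fderiv ℝ (fderiv ℝ P.f) x + ∑ j, mu j • fderiv ℝ (fderiv ℝ fun z => P.c z j) x) x :=
    ((hf.fderiv_right (m := 1) (by norm_num)).differentiableAt (by norm_num)).hasFDerivAt.add
      (HasFDerivAt.fun_sum fun j _ => (((hcj j).fderiv_right (m := 1)
        (by norm_num)).differentiableAt (by norm_num)).hasFDerivAt.const_smul (mu j))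
  rw [hG, h1.fderiv_eq, h2.fderiv, hessianLagrangian, Matrix.add_mulVec, dotProduct_add,
    hessian_dotProduct, Matrix.sum_mulVec, dotProduct_sum]
  simp only [Matrix.smul_mulVec, dotProduct_smul, hessian_dotProduct, _root_.add_apply,
    _root_.sum_apply, _root_.smul_apply]

theorem licq_inner {x : EuclideanSpace ℝ (Fin n)}
    (h : LinearIndependent ℝ (P.constraintJacobian x).row) (mu : EuclideanSpace ℝ (Fin p))
    (l : EuclideanSpace ℝ (Fin q))
    (h1 : ∀ d, inner ℝ mu (fderiv ℝ P.c x d) + inner ℝ l (P.opA d) = 0)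
    (h2 : ∀ e, inner ℝ l (P.opB e) = 0) : mu = 0 ∧ l = 0 := by
  have e1 : (jacobian P.c x)ᵀ.toEuclideanLin mu + P.Aᵀ.toEuclideanLin l = 0 := by
    rw [← inner_self_eq_zero (𝕜 := ℝ)]
    rw [inner_add_left, inner_transpose_toEuclideanLin, inner_transpose_toEuclideanLin,
      jacobian_toEuclideanLin]
    exact h1 _
  have e2 : P.Bᵀ.toEuclideanLin l = 0 := by
    rw [← inner_self_eq_zero (𝕜 := ℝ), inner_transpose_toEuclideanLin]
    exact h2 _
  have e1' : mu.ofLp ᵥ* jacobian P.c x + l.ofLp ᵥ* P.A = 0 := by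
    rw [← Matrix.mulVec_transpose, ← Matrix.mulVec_transpose]
    exact congrArg WithLp.ofLp e1
  have e2' : l.ofLp ᵥ* P.B = 0 := by
    rw [← Matrix.mulVec_transpose]
    exact congrArg WithLp.ofLp e2
  have e3 : Sum.elim mu.ofLp l.ofLp ᵥ* P.constraintJacobian x = 0 ᵥ* P.constraintJacobian x := by
    rw [constraintJacobian, Matrix.vecMul_fromBlocks, Matrix.zero_vecMul]
    simp [e1', e2']
  have e4 := Matrix.vecMul_injective_iff.2 h e3
  constructor
  · ext j
    exact congrFun e4 (Sum.inl j)
  · ext j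
    exact congrFun e4 (Sum.inr j)

theorem sosc_fderiv {xs : EuclideanSpace ℝ (Fin n)} {ys : EuclideanSpace ℝ (Fin m)}
    {mus : EuclideanSpace ℝ (Fin p)} {lams : EuclideanSpace ℝ (Fin q)}
    (hreg : P.IsRegularKKT xs ys mus lams) (d : EuclideanSpace ℝ (Fin n))
    (e : EuclideanSpace ℝ (Fin m)) (hne : (d, e) ≠ 0) (hJ : fderiv ℝ P.c xs d = 0)
    (hAB : P.opA d + P.opB e = 0) :
    0 < fderiv ℝ (fderiv ℝ fun x => P.f x + inner ℝ mus (P.c x)) xs d d := by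
  have h := hreg.sosc (Sum.elim d.ofLp e.ofLp)
    (by
      intro h0
      apply hne
      refine Prod.ext ?_ ?_
      · ext i
        exact congrFun h0 (Sum.inl i)
      · ext i
        exact congrFun h0 (Sum.inr i))
    (by
      rw [← jacobian_toEuclideanLin] at hJ
      have h1 : jacobian P.c xs *ᵥ d.ofLp = 0 := congrArg WithLp.ofLp hJ
      have h2 : P.A *ᵥ d.ofLp + P.B *ᵥ e.ofLp = 0 := congrArg WithLp.ofLp hAB
      rw [constraintJacobian, Matrix.fromBlocks_mulVec]
      simp [h1, h2])
  rw [← P.hessianLagrangian_dotProduct hreg.f_contDiffAt hreg.c_contDiffAt]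
  rw [Matrix.fromBlocks_mulVec] at h
  simpa using h

end Problem

end ADMM

theorem mainTheorem1 {n m p q : ℕ} (P : ADMM.Problem n m p q)
    (xs : EuclideanSpace ℝ (Fin n)) (ys : EuclideanSpace ℝ (Fin m))
    (mus : EuclideanSpace ℝ (Fin p)) (lams : EuclideanSpace ℝ (Fin q))
    (hreg : P.IsRegularKKT xs ys mus lams) :
    ∃ ρs : ℝ, 0 < ρs ∧ ∀ ρ : ℝ, ρs < ρ → ∃ ε' : ℝ, 0 < ε' ∧
      ∀ (x : ℕ → EuclideanSpace ℝ (Fin n)) (y : ℕ → EuclideanSpace ℝ (Fin m))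
        (mu : ℕ → EuclideanSpace ℝ (Fin p)) (lam : ℕ → EuclideanSpace ℝ (Fin q)),
        P.IsIteration ρ x y mu lam →
        P.IsNearest ρ xs mus x y mu lam →
        (∃ K : ℕ, ADMM.pairNorm (y K - ys) (lam K - lams) < ε') →
        Tendsto (fun k : ℕ => (x (k + 1), y (k + 1), mu (k + 1), lam (k + 1))) atTop
          (𝓝 (xs, ys, mus, lams)) := by
  obtain ⟨ρs, hρs, h⟩ := ADMM.exists_penalty_tendsto (A := P.opA) (B := P.opB) (b := P.b)
    hreg.f_contDiff hreg.c_contDiff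
    hreg.f_contDiffAt hreg.c_contDiffAt hreg.kkt.feasible_c hreg.kkt.feasible_lin
    (P.gradLagrangian_eq_zero_iff.1 hreg.kkt.stationary_x)
    (P.inner_opB_eq_zero hreg.kkt.stationary_y) (P.licq_inner hreg.licq) (P.sosc_fderiv hreg)
  refine ⟨ρs, hρs, fun ρ hρ => ?_⟩
  obtain ⟨ε, hε, hconv⟩ := h ρ hρ
  refine ⟨ε, hε, fun x y mu lam hit hnear ⟨K, hK⟩ => ?_⟩
  refine hconv x y mu lam ?_ hit.lam_step (fun k => (hit.mu_step k).2)
    (fun k => P.gradLagrangian_eq_zero_iff.1 (hit.mu_step k).1) ?_ ⟨K, ?_, ?_⟩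
  -- Bᵀλ⁰ = 0 is assumed; for later iterates it is the optimality condition of the preceding y-step.
  · rintro (_ | k) v
    · exact P.inner_opB_eq_zero hit.init v
    · rw [hit.lam_step k]
      exact P.inner_opB_eq_zero_of_isMinOn (hit.y_step k) v
  · intro k x' mu' hc' hmin' hst'
    have h1 := hnear k x' mu' ⟨⟨hc', hmin'⟩, P.gradLagrangian_eq_zero_iff.2 hst', hc'⟩
    rw [ADMM.pairNorm, ADMM.pairNorm, Real.sqrt_le_sqrt_iff (by positivity)] at h1
    nlinarith [sq_nonneg ‖mu (k + 1) - mus‖]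
  · refine lt_of_le_of_lt (Real.le_sqrt_of_sq_le ?_) hK
    linarith [sq_nonneg ‖lam K - lams‖]
  · refine lt_of_le_of_lt (Real.le_sqrt_of_sq_le ?_) hK
    linarith [sq_nonneg ‖y K - ys‖]
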